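/- **Proposition 2 (Algorithm for the Christoffel-Consistent Factorization).** *Setting.* Consider a kinematic tree of rigid bodies $1,\dots,N$ on a fixed base $0$; body $i$ is connected to its predecessor $p(i)\in\{0,\dots,i-1\}$ by a joint with one degree of freedom and coordinate $q_i\in\mathbb R$. The pose of the frame of body $i$ relative to the frame of $p(i)$ is a $C^2$ function of $q_i$: a rotation $R_i(q_i)\in SO(3)$ from coordinates of frame $i$ to coordinates of frame $p(i)$, and a position $r_i(q_i)\in\mathbb R^3$ of the origin of frame $i$ in frame $p(i)$. Let $S(x)$ be the matrix of $y\mapsto x\times y$ on $\mathbb R^3$. For motion vectors $\mathbf v=(\omega,v)$ and force vectors $\mathbf f=(n,f)$ in $\mathbb R^6$ put $$(\mathbf v\times)=\begin{bmatrix}S(\omega)&0\\S(v)&S(\omega)\end{bmatrix},\qquad (\mathbf v\times^*)=-(\mathbf v\times)^{\top},\qquad (\mathbf f\,\bar\times^*)\mathbf v=(\mathbf v\times^*)\mathbf f .$$ The transform of motion vectors from frame $p(i)$ to frame $i$ and the joint axis in frame $i$ are $$X_i=\begin{bmatrix}R_i^\top&0\\-R_i^\top S(r_i)&R_i^\top\end{bmatrix},\qquad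 \Phi_i=(\omega_i,\;R_i^\top r_i'),\quad S(\omega_i)=R_i^\top R_i',$$ and $\mathring\Phi_i=\frac{d\Phi_i}{dq_i}\dot q_i$ is the rate of change of the axis in local coordinates. Body $i$ has the constant spatial inertia $I_i=\begin{bmatrix}\bar I_i&m_iS(c_i)\\m_iS(c_i)^\top&m_i\mathbf 1_3\end{bmatrix}$ in its frame, with $\bar I_i$ symmetric. The body velocities are $\mathbf v_0=0$, $\mathbf v_i=X_i\mathbf v_{p(i)}+\Phi_i\dot q_i$, and the mass matrix $M(q)$ is the symmetric matrix with $\frac12\sum_k\mathbf v_k^\top I_k\mathbf v_k=\frac12\dot q^\top M(q)\dot q$. *Algorithm 1 (input $q,\dot q$; all entries of the outputs start at $0$).* For $i=1,\dots,N$: set $\mathbf v_i=X_i\mathbf v_{p(i)}+\Phi_i\dot q_i$, $\dot\Phi_i=(\mathbf v_i\times)\Phi_i+\mathring\Phi_i$, $I_i^C=I_i$ and $B_i^C=B(\mathbf v_i,I_i)$, where $$B(\mathbf v,I)=\tfrac12\big[(\mathbf v\times^*)I+((I\mathbf v)\,\bar\times^*)-I(\mathbf v\times)\big]$$ is the Niemeyer–Slotine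 body-level factorization. For $j=N,\dots,1$: set $F_1=I_j^C\dot\Phi_j+B_j^C\Phi_j$, $F_2=I_j^C\Phi_j$, $F_3=(B_j^C)^\top\Phi_j$, $C_{jj}=\Phi_j^\top F_1$, $M_{jj}=\Phi_j^\top F_2$, $\dot M_{jj}=\dot\Phi_j^\top F_2+\Phi_j^\top(F_1+F_3)$ and $i=j$; while $p(i)>0$, replace $F_1,F_2,F_3$ by $X_i^\top F_1,X_i^\top F_2,X_i^\top F_3$, replace $i$ by $p(i)$, and set $C_{ij}=\Phi_i^\top F_1$, $C_{ji}=\dot\Phi_i^\top F_2+\Phi_i^\top F_3$, $M_{ij}=M_{ji}=\Phi_i^\top F_2$, $\dot M_{ij}=\dot M_{ji}=\dot\Phi_i^\top F_2+\Phi_i^\top(F_1+F_3)$; afterwards add $X_j^\top I_j^CX_j$ to $I_{p(j)}^C$ and $X_j^\top B_j^CX_j$ to $B_{p(j)}^C$. Return $M,\dot M,C$. *Claim.* Suppose that $\mathring\Phi_i=0$ for every joint (for all $q,\dot q$). Then $M$ is a differentiable function of $q$, and for all $q,\dot q\in\mathbb R^N$ the matrix $C$ returned by Algorithm 1 is the Christoffel-consistent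 Coriolis matrix $$C_{ij}=\sum_k\Gamma_{ijk}(q)\,\dot q_k,\qquad \Gamma_{ijk}=\frac12\left[\frac{\partial M_{ij}}{\partial q_k}+\frac{\partial M_{ik}}{\partial q_j}-\frac{\partial M_{jk}}{\partial q_i}\right].$$ -/

import Mathlib

open scoped Matrix

namespace RigidBodyTree

noncomputable section

/-! ### Spatial vector algebra in coordinates -/

/-- Coordinates of a spatial motion vector (angular part, then linear part) or of a spatial force
vector (moment part, then linear part) in a Cartesian frame. -/
abbrev SpatialVec : Type := Fin 3 ⊕ Fin 3 → ℝ

/-- Coordinates of a linear operator between spaces of spatial vectors. -/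
abbrev SpatialMat : Type := Matrix (Fin 3 ⊕ Fin 3) (Fin 3 ⊕ Fin 3) ℝ

/-- The angular (resp. moment) part of a spatial vector. -/
def angPart (v : SpatialVec) : Fin 3 → ℝ := fun a => v (Sum.inl a)

/-- The linear part of a spatial vector. -/
def linPart (v : SpatialVec) : Fin 3 → ℝ := fun a => v (Sum.inr a)

/-- The skew-symmetric matrix `S(p)` of the map `x ↦ p × x` on `ℝ³`. -/
def skew (p : Fin 3 → ℝ) : Matrix (Fin 3) (Fin 3) ℝ :=
  !![0, -p 2, p 1; p 2, 0, -p 0; -p 1, p 0, 0]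

/-- The vector `w` with `S(w) = A`, for a skew-symmetric matrix `A`. -/
def unskew (A : Matrix (Fin 3) (Fin 3) ℝ) : Fin 3 → ℝ := ![A 2 1, A 0 2, A 1 0]

/-- The matrix of the motion/motion cross product `(v ×)`. -/
def motionCross (v : SpatialVec) : SpatialMat :=
  Matrix.fromBlocks (skew (angPart v)) 0 (skew (linPart v)) (skew (angPart v))

/-- The matrix of the motion/force cross product `(v ×*) = -(v ×)ᵀ`. -/
def forceCross (v : SpatialVec) : SpatialMat := -(motionCross v)ᵀ

/-- The matrix of `(f ×̄*)`, the operator with `(f ×̄*) v = (v ×*) f`. -/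
def forceBarCross (f : SpatialVec) : SpatialMat :=
  Matrix.fromBlocks (-skew (angPart f)) (-skew (linPart f)) (-skew (linPart f)) 0

/-- The defining property of `(f ×̄*)`. -/
theorem forceBarCross_mulVec (f v : SpatialVec) :
    forceBarCross f *ᵥ v = forceCross v *ᵥ f := by
  funext a
  rcases a with a | a <;> fin_cases a <;>
    simp [forceBarCross, forceCross, motionCross, skew, angPart, linPart, Matrix.mulVec,
      dotProduct, Fin.sum_univ_three] <;> ring

/-- The Niemeyer–Slotine body-level factorization
`B(v, I) = ½ [(v ×*) I + ((I v) ×̄*) - I (v ×)]`. -/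
def niemeyerSlotine (v : SpatialVec) (I : SpatialMat) : SpatialMat :=
  (1 / 2 : ℝ) • (forceCross v * I + forceBarCross (I *ᵥ v) - I * motionCross v)

/-- The inertial parameters of a rigid body, in a body-fixed frame: mass, position of the centre
of mass, and (symmetric) rotational inertia tensor about the origin of the frame. -/
structure Inertia where
  mass : ℝ
  com : Fin 3 → ℝ
  rotInertia : Matrix (Fin 3) (Fin 3) ℝ
  rotInertia_symm : rotInertia.IsSymm

/-- The spatial inertia matrix. -/
def Inertia.toMat (J : Inertia) : SpatialMat :=
  Matrix.fromBlocks J.rotInertia (J.mass • skew J.com) (J.mass • (skew J.com)ᵀ)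
    (J.mass • (1 : Matrix (Fin 3) (Fin 3) ℝ))

/-! ### Single-degree-of-freedom joints -/

/-- A joint with one degree of freedom: the pose of the frame of a body relative to the frame of
its predecessor, as a function of the joint coordinate `s`. The matrix `rot s` takes coordinates in
the body frame to coordinates in the predecessor frame, and `pos s` is the vector from the origin
of the predecessor frame to the origin of the body frame, in the predecessor frame. -/
structure Joint where
  rot : ℝ → Matrix (Fin 3) (Fin 3) ℝ
  pos : ℝ → Fin 3 → ℝ
  rot_mem : ∀ s, rot s ∈ Matrix.specialOrthogonalGroup (Fin 3) ℝ
  contDiff_rot : ∀ a b, ContDiff ℝ 2 fun s => rot s a b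
  contDiff_pos : ∀ a, ContDiff ℝ 2 fun s => pos s a

/-- The spatial transform of motion vectors from the predecessor frame to the body frame; the
rotation from predecessor to body coordinates is `(rot s)ᵀ`. -/
def Joint.transform (J : Joint) (s : ℝ) : SpatialMat :=
  Matrix.fromBlocks (J.rot s)ᵀ 0 (-((J.rot s)ᵀ * skew (J.pos s))) (J.rot s)ᵀ

/-- The joint axis `Φ`, in the body frame: the spatial velocity of the body relative to its
predecessor at unit joint rate. Its angular part `ω` is given by `S(ω) = Rᵀ R'`, its linear part
is `Rᵀ p'`. -/
def Joint.axis (J : Joint) (s : ℝ) : SpatialVec :=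
  Sum.elim
    (unskew ((J.rot s)ᵀ * Matrix.of fun a b => deriv (fun t => J.rot t a b) s))
    ((J.rot s)ᵀ *ᵥ fun a => deriv (fun t => J.pos t a) s)

/-! ### Kinematic trees -/

/-- A kinematic tree of `N` rigid bodies, each connected to its predecessor by a joint with one
degree of freedom. The predecessor `none` is the fixed base. -/
structure Tree (N : ℕ) where
  parent : Fin N → Option (Fin N)
  parent_lt : ∀ i p, parent i = some p → p < i
  joint : Fin N → Joint
  inertia : Fin N → Inertia

variable {N : ℕ}

/-- The spatial transform from the frame of the predecessor of body `i` to the frame of `i`. -/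
def Tree.X (T : Tree N) (q : Fin N → ℝ) (i : Fin N) : SpatialMat := (T.joint i).transform (q i)

/-- The axis `Φ_i` of joint `i`, in the frame of body `i`. -/
def Tree.axis (T : Tree N) (q : Fin N → ℝ) (i : Fin N) : SpatialVec := (T.joint i).axis (q i)

/-- The rate of change of the axis of joint `i` in local coordinates (`Φ_i` with a ring on top):
the time derivative of the coordinates of `Φ_i` in the frame of body `i`. -/
def Tree.axisRate (T : Tree N) (q qd : Fin N → ℝ) (i : Fin N) : SpatialVec :=
  qd i • deriv (T.joint i).axis (q i)

/-- The spatial velocity of body `i`, in the frame of body `i`. -/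
def Tree.velocity (T : Tree N) (q qd : Fin N → ℝ) (i : Fin N) : SpatialVec :=
  (match h : T.parent i with
    | none => 0
    | some p =>
      have : p < i := T.parent_lt i p h
      T.X q i *ᵥ T.velocity q qd p) + qd i • T.axis q i
termination_by i

/-- The mass matrix: the symmetric matrix of the kinetic energy
`½ ∑ₖ vₖᵀ Iₖ vₖ = ½ q̇ᵀ M(q) q̇` as a quadratic form in the joint rates. -/
def Tree.massMatrix (T : Tree N) (q : Fin N → ℝ) : Matrix (Fin N) (Fin N) ℝ :=
  Matrix.of fun i j => ∑ k : Fin N,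
    T.velocity q (Pi.single i 1) k ⬝ᵥ ((T.inertia k).toMat *ᵥ T.velocity q (Pi.single j 1) k)

/-- The partial derivative of `f` with respect to the `k`-th coordinate, at `q`. -/
def partialDeriv (f : (Fin N → ℝ) → ℝ) (k : Fin N) (q : Fin N → ℝ) : ℝ :=
  deriv (fun s => f (Function.update q k s)) (q k)

/-- The Christoffel symbols of the first kind of the mass matrix. -/
def Tree.christoffel (T : Tree N) (q : Fin N → ℝ) (i j k : Fin N) : ℝ :=
  (1 / 2 : ℝ) * (partialDeriv (fun x => T.massMatrix x i j) k q
    + partialDeriv (fun x => T.massMatrix x i k) j q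
    - partialDeriv (fun x => T.massMatrix x j k) i q)

/-- The Christoffel-consistent Coriolis factorization. -/
def Tree.christoffelCoriolis (T : Tree N) (q qd : Fin N → ℝ) : Matrix (Fin N) (Fin N) ℝ :=
  Matrix.of fun i j => ∑ k : Fin N, T.christoffel q i j k * qd k

/-! ### The Coriolis matrix algorithm -/

/-- The variables of the algorithm. An index `none` refers to the fixed base. -/
structure State (N : ℕ) where
  v : Option (Fin N) → SpatialVec
  axisDot : Fin N → SpatialVec
  IC : Option (Fin N) → SpatialMat
  BC : Option (Fin N) → SpatialMat
  M : Matrix (Fin N) (Fin N) ℝ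
  Mdot : Matrix (Fin N) (Fin N) ℝ
  C : Matrix (Fin N) (Fin N) ℝ

/-- The variables before the first loop. -/
def State.init : State N where
  v := fun _ => 0
  axisDot := fun _ => 0
  IC := fun _ => 0
  BC := fun _ => 0
  M := 0
  Mdot := 0
  C := 0

/-- The assignment `A i j := x`. -/
def setEntry (A : Matrix (Fin N) (Fin N) ℝ) (i j : Fin N) (x : ℝ) : Matrix (Fin N) (Fin N) ℝ :=
  Matrix.of fun a b => if a = i ∧ b = j then x else A a b

/-- The body of the forward loop, for body `i`. -/
def Tree.forwardStep (T : Tree N) (B : SpatialVec → SpatialMat → SpatialMat)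
    (q qd : Fin N → ℝ) (σ : State N) (i : Fin N) : State N :=
  let vi := T.X q i *ᵥ σ.v (T.parent i) + qd i • T.axis q i
  { σ with
    v := Function.update σ.v (some i) vi
    axisDot := Function.update σ.axisDot i (motionCross vi *ᵥ T.axis q i + T.axisRate q qd i)
    IC := Function.update σ.IC (some i) (T.inertia i).toMat
    BC := Function.update σ.BC (some i) (B vi (T.inertia i).toMat) }

/-- The inner loop for body `j`, started at the current value of `i`: while `i` has a predecessor
other than the base, transform `F₁`, `F₂`, `F₃` to its frame, replace `i` by it, and set the entries
of the output matrices at `(i, j)` and `(j, i)`. -/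
def Tree.innerLoop (T : Tree N) (q : Fin N → ℝ) (j : Fin N) (i : Fin N)
    (F₁ F₂ F₃ : SpatialVec) (σ : State N) : State N :=
  match h : T.parent i with
  | none => σ
  | some p =>
    have : p < i := T.parent_lt i p h
    let G₁ := (T.X q i)ᵀ *ᵥ F₁
    let G₂ := (T.X q i)ᵀ *ᵥ F₂
    let G₃ := (T.X q i)ᵀ *ᵥ F₃
    let c₁ := T.axis q p ⬝ᵥ G₁
    let c₂ := σ.axisDot p ⬝ᵥ G₂ + T.axis q p ⬝ᵥ G₃
    let m := T.axis q p ⬝ᵥ G₂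
    let md := σ.axisDot p ⬝ᵥ G₂ + T.axis q p ⬝ᵥ (G₁ + G₃)
    T.innerLoop q j p G₁ G₂ G₃
      { σ with
        C := setEntry (setEntry σ.C p j c₁) j p c₂
        M := setEntry (setEntry σ.M p j m) j p m
        Mdot := setEntry (setEntry σ.Mdot p j md) j p md }
termination_by i

/-- The body of the backward loop, for body `j`. -/
def Tree.backwardStep (T : Tree N) (q : Fin N → ℝ) (σ : State N) (j : Fin N) : State N :=
  let F₁ := σ.IC (some j) *ᵥ σ.axisDot j + σ.BC (some j) *ᵥ T.axis q j
  let F₂ := σ.IC (some j) *ᵥ T.axis q j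
  let F₃ := (σ.BC (some j))ᵀ *ᵥ T.axis q j
  let τ := T.innerLoop q j j F₁ F₂ F₃
    { σ with
      C := setEntry σ.C j j (T.axis q j ⬝ᵥ F₁)
      M := setEntry σ.M j j (T.axis q j ⬝ᵥ F₂)
      Mdot := setEntry σ.Mdot j j (σ.axisDot j ⬝ᵥ F₂ + T.axis q j ⬝ᵥ (F₁ + F₃)) }
  { τ with
    IC := Function.update τ.IC (T.parent j)
      (τ.IC (T.parent j) + (T.X q j)ᵀ * τ.IC (some j) * T.X q j)
    BC := Function.update τ.BC (T.parent j)
      (τ.BC (T.parent j) + (T.X q j)ᵀ * τ.BC (some j) * T.X q j) }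

/-- The Coriolis matrix algorithm with body-level factorization `B`: a forward loop over the
bodies in increasing order, then a backward loop in decreasing order. The results are the
components `M`, `Mdot` and `C` of the final state. -/
def Tree.coriolisAlgorithm (T : Tree N) (B : SpatialVec → SpatialMat → SpatialMat)
    (q qd : Fin N → ℝ) : State N :=
  (List.finRange N).reverse.foldl (T.backwardStep q)
    ((List.finRange N).foldl (T.forwardStep B q qd) State.init)

end

end RigidBodyTree

namespace RigidBodyTree

/-! ### Spatial algebra -/

/-! Fix a body k with inertia I and let J_i be its velocity at unit rate of joint i alone, that is,
the axis of joint i carried to the frame of k (`Tree.velocity_single`). The mass matrix is the sum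
over k of J_iᵀ I J_j. With axes constant in local coordinates, q enters only through the transforms
X, whose derivative is -(Φ ×) X, and the derivative D_l J_i of J_i along q_l is
`Tree.velocityDeriv`.

Two identities carry the mechanics. First, D_l J_i - D_i J_l = -(J_l × J_i)
(`Tree.velocityDeriv_sub_comm`). Second, v_k × J_j plus the derivative of J_j along the motion is
v_j × Φ_j carried from body j to body k (`Tree.transport_mulVec_axisDot`). By the first, the
derivatives along q_i cancel in the Christoffel symbol, and each body contributes J_iᵀ I (J_l × J_j
+ D_l J_j) + J_iᵀ B(J_l, I) J_j with precisely the Niemeyer–Slotine B (`Tree.christoffel_eq_sum`).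
Linearity in the rates and the second identity turn this into `Tree.bodySum`.

It remains to see that the algorithm evaluates `Tree.bodySum`, which holds for any B
(`Tree.coriolisAlgorithm_C`). A summand survives only if k lies in the subtrees of both i and j. The
ancestors of k form a chain, so unrelated pairs give zero. If i is above j, the sum factors through
the composite operators at j, which obey the child-to-parent recursion `Tree.composite_eq`. -/

theorem skew_add (x y : Fin 3 → ℝ) : skew (x + y) = skew x + skew y := by
  ext a b; fin_cases a <;> fin_cases b <;> simp [skew] <;> ring

theorem skew_smul (c : ℝ) (x : Fin 3 → ℝ) : skew (c • x) = c • skew x := by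
  ext a b; fin_cases a <;> fin_cases b <;> simp [skew]

theorem skew_transpose (x : Fin 3 → ℝ) : (skew x)ᵀ = -skew x := by
  ext a b; fin_cases a <;> fin_cases b <;> simp [skew]

theorem skew_unskew {A : Matrix (Fin 3) (Fin 3) ℝ} (hA : Aᵀ = -A) : skew (unskew A) = A := by
  have h : ∀ a b, A b a = -A a b := fun a b => congrFun (congrFun hA a) b
  have h00 := h 0 0
  have h11 := h 1 1
  have h22 := h 2 2
  have h01 := h 0 1
  have h02 := h 0 2
  have h12 := h 1 2
  ext a b; fin_cases a <;> fin_cases b <;> simp [skew, unskew] <;> linarith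

/-- The Jacobi identity for the cross product. -/
theorem skew_mulVec_skew (x y : Fin 3 → ℝ) :
    skew (skew x *ᵥ y) = skew x * skew y - skew y * skew x := by
  ext a b; fin_cases a <;> fin_cases b <;>
    simp [skew, Matrix.mulVec, dotProduct, Fin.sum_univ_three] <;> ring

/-- As a bilinear form, this is multiplicativity of the determinant on the triple product: Ay · (Ax
× Az) = det A (y · (x × z)). -/
theorem transpose_mul_skew_mulVec_mul (A : Matrix (Fin 3) (Fin 3) ℝ) (x : Fin 3 → ℝ) :
    Aᵀ * skew (A *ᵥ x) * A = A.det • skew x := by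
  ext a b; fin_cases a <;> fin_cases b <;>
    simp [skew, Matrix.mulVec, dotProduct, Matrix.mul_apply, Fin.sum_univ_three,
      Matrix.det_fin_three] <;> ring

theorem transpose_mul_skew {R : Matrix (Fin 3) (Fin 3) ℝ}
    (hR : R ∈ Matrix.specialOrthogonalGroup (Fin 3) ℝ) (x : Fin 3 → ℝ) :
    Rᵀ * skew x = skew (Rᵀ *ᵥ x) * Rᵀ := by
  obtain ⟨hO, hd⟩ := Matrix.mem_specialOrthogonalGroup_iff.1 hR
  have h1 : R * Rᵀ = 1 := (Matrix.mem_orthogonalGroup_iff (Fin 3) ℝ).1 hO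
  have h := transpose_mul_skew_mulVec_mul R (Rᵀ *ᵥ x)
  rw [hd, one_smul, Matrix.mulVec_mulVec, h1, Matrix.one_mulVec] at h
  rw [← h, Matrix.mul_assoc _ R, h1, Matrix.mul_one]

theorem motionCross_add (v w : SpatialVec) :
    motionCross (v + w) = motionCross v + motionCross w := by
  have h1 : angPart (v + w) = angPart v + angPart w := rfl
  have h2 : linPart (v + w) = linPart v + linPart w := rfl
  simp [motionCross, h1, h2, skew_add, Matrix.fromBlocks_add]

theorem motionCross_smul (c : ℝ) (v : SpatialVec) :
    motionCross (c • v) = c • motionCross v := by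
  have h1 : angPart (c • v) = c • angPart v := rfl
  have h2 : linPart (c • v) = c • linPart v := rfl
  simp [motionCross, h1, h2, skew_smul, Matrix.fromBlocks_smul]

theorem motionCross_mulVec_comm (v w : SpatialVec) :
    motionCross v *ᵥ w = -(motionCross w *ᵥ v) := by
  funext a
  rcases a with a | a <;> fin_cases a <;>
    simp [motionCross, skew, angPart, linPart, Matrix.mulVec, dotProduct,
      Fin.sum_univ_three] <;> ring

theorem motionCross_mulVec_self (v : SpatialVec) : motionCross v *ᵥ v = 0 := by
  have h := motionCross_mulVec_comm v v
  funext a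
  have h' := congrFun h a
  simp only [Pi.neg_apply] at h'
  simp only [Pi.zero_apply]
  linarith

theorem Inertia.toMat_transpose (J : Inertia) : J.toMatᵀ = J.toMat := by
  simp [Inertia.toMat, Matrix.fromBlocks_transpose, J.rotInertia_symm.eq, Matrix.transpose_smul]

/-! ### Joints -/

theorem angPart_transform_mulVec (J : Joint) (s : ℝ) (v : SpatialVec) :
    angPart (J.transform s *ᵥ v) = (J.rot s)ᵀ *ᵥ angPart v := by
  funext a
  simp [angPart, Joint.transform, Matrix.fromBlocks_mulVec]
  rfl

theorem linPart_transform_mulVec (J : Joint) (s : ℝ) (v : SpatialVec) :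
    linPart (J.transform s *ᵥ v) =
      (J.rot s)ᵀ *ᵥ (linPart v + (-1 : ℝ) • (skew (J.pos s) *ᵥ angPart v)) := by
  funext a
  simp [linPart, Joint.transform, Matrix.fromBlocks_mulVec, Matrix.mulVec_add, Matrix.mulVec_neg,
    Matrix.neg_mulVec, Matrix.mulVec_mulVec]
  rw [add_comm]
  rfl

/-- Transforms of motion vectors commute with the motion cross product. -/
theorem transform_mul_motionCross (J : Joint) (s : ℝ) (v : SpatialVec) :
    J.transform s * motionCross v = motionCross (J.transform s *ᵥ v) * J.transform s := by
  have h := transpose_mul_skew (J.rot_mem s)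
  rw [motionCross, motionCross, angPart_transform_mulVec, linPart_transform_mulVec,
    Joint.transform, Matrix.fromBlocks_multiply, Matrix.fromBlocks_multiply]
  simp only [Matrix.mul_zero, Matrix.zero_mul, add_zero, zero_add, Matrix.mul_neg,
    ← Matrix.mul_assoc, ← h]
  simp only [skew_add, skew_smul, skew_mulVec_skew, Matrix.mul_add, Matrix.mul_smul,
    Matrix.mul_sub, Matrix.neg_mul, Matrix.mul_assoc, neg_zero, add_zero]
  congr 1
  rw [neg_one_smul]
  abel

theorem transform_mulVec_motionCross (J : Joint) (s : ℝ) (v w : SpatialVec) :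
    J.transform s *ᵥ (motionCross v *ᵥ w) =
      motionCross (J.transform s *ᵥ v) *ᵥ (J.transform s *ᵥ w) := by
  rw [Matrix.mulVec_mulVec, transform_mul_motionCross, ← Matrix.mulVec_mulVec]

/-- The derivative of the rotation of a joint. -/
noncomputable def Joint.rotDeriv (J : Joint) (s : ℝ) : Matrix (Fin 3) (Fin 3) ℝ :=
  Matrix.of fun a b => deriv (fun t => J.rot t a b) s

/-- The derivative of the position of a joint. -/
noncomputable def Joint.posDeriv (J : Joint) (s : ℝ) : Fin 3 → ℝ :=
  fun a => deriv (fun t => J.pos t a) s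

theorem Joint.hasDerivAt_rot (J : Joint) (s : ℝ) (a b : Fin 3) :
    HasDerivAt (fun t => J.rot t a b) (J.rotDeriv s a b) s :=
  ((J.contDiff_rot a b).differentiable (by norm_num) s).hasDerivAt

theorem Joint.hasDerivAt_pos (J : Joint) (s : ℝ) (a : Fin 3) :
    HasDerivAt (fun t => J.pos t a) (J.posDeriv s a) s :=
  ((J.contDiff_pos a).differentiable (by norm_num) s).hasDerivAt

theorem Joint.transpose_rot_mul_rot (J : Joint) (s : ℝ) : (J.rot s)ᵀ * J.rot s = 1 :=
  (Matrix.mem_orthogonalGroup_iff' (Fin 3) ℝ).1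
    (Matrix.mem_specialOrthogonalGroup_iff.1 (J.rot_mem s)).1

theorem Joint.rot_mul_transpose_rot (J : Joint) (s : ℝ) : J.rot s * (J.rot s)ᵀ = 1 :=
  (Matrix.mem_orthogonalGroup_iff (Fin 3) ℝ).1
    (Matrix.mem_specialOrthogonalGroup_iff.1 (J.rot_mem s)).1

/-- Differentiate the constant RᵀR = 1. Hence `unskew` loses nothing in the definition of the axis.
-/
theorem Joint.transpose_rot_mul_rotDeriv_skew (J : Joint) (s : ℝ) :
    ((J.rot s)ᵀ * J.rotDeriv s)ᵀ = -((J.rot s)ᵀ * J.rotDeriv s) := by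
  ext a b
  have h : HasDerivAt (fun t => ((J.rot t)ᵀ * J.rot t) a b)
      (∑ c, (J.rotDeriv s c a * J.rot s c b + J.rot s c a * J.rotDeriv s c b)) s := by
    simp only [Matrix.mul_apply, Matrix.transpose_apply]
    exact HasDerivAt.fun_sum fun c _ => (J.hasDerivAt_rot s c a).mul (J.hasDerivAt_rot s c b)
  simp only [J.transpose_rot_mul_rot] at h
  have h0 := h.unique (hasDerivAt_const s _)
  rw [Finset.sum_add_distrib] at h0
  simp only [Matrix.transpose_apply, Matrix.neg_apply, Matrix.mul_apply]
  simp only [mul_comm (J.rotDeriv s _ a)] at h0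
  linarith

theorem Joint.skew_angPart_axis (J : Joint) (s : ℝ) :
    skew (angPart (J.axis s)) = (J.rot s)ᵀ * J.rotDeriv s :=
  skew_unskew (J.transpose_rot_mul_rotDeriv_skew s)

theorem Joint.linPart_axis (J : Joint) (s : ℝ) :
    linPart (J.axis s) = (J.rot s)ᵀ *ᵥ J.posDeriv s := rfl

theorem Joint.transpose_rotDeriv (J : Joint) (s : ℝ) :
    (J.rotDeriv s)ᵀ = -(skew (angPart (J.axis s)) * (J.rot s)ᵀ) := by
  rw [← Matrix.neg_mul, ← skew_transpose, J.skew_angPart_axis, Matrix.transpose_mul,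
    Matrix.transpose_transpose, Matrix.mul_assoc, J.rot_mul_transpose_rot, Matrix.mul_one]

theorem hasDerivAt_skew {x : ℝ → Fin 3 → ℝ} {x' : Fin 3 → ℝ} {s : ℝ}
    (h : ∀ a, HasDerivAt (fun t => x t a) (x' a) s) (a b : Fin 3) :
    HasDerivAt (fun t => skew (x t) a b) (skew x' a b) s := by
  fin_cases a <;> fin_cases b <;> simp [skew] <;>
    first
      | exact hasDerivAt_const _ _
      | exact h _
      | exact (h _).fun_neg

/-- The right side is the blockwise derivative of the transform, so this is the equation X' = -(Φ ×)
X. -/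
theorem Joint.neg_motionCross_axis_mul_transform (J : Joint) (s : ℝ) :
    -(motionCross (J.axis s) * J.transform s) =
      Matrix.fromBlocks (J.rotDeriv s)ᵀ 0
        (-((J.rotDeriv s)ᵀ * skew (J.pos s) + (J.rot s)ᵀ * skew (J.posDeriv s)))
        (J.rotDeriv s)ᵀ := by
  rw [transpose_mul_skew (J.rot_mem s), motionCross, Joint.transform, J.linPart_axis,
    Matrix.fromBlocks_multiply, J.transpose_rotDeriv, Matrix.fromBlocks_neg]
  simp only [Matrix.mul_zero, Matrix.zero_mul, add_zero, zero_add, Matrix.mul_neg, neg_zero,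
    Matrix.neg_mul, Matrix.mul_assoc]
  congr 1
  abel

theorem Joint.hasDerivAt_transform (J : Joint) (s : ℝ) (a b : Fin 3 ⊕ Fin 3) :
    HasDerivAt (fun t => J.transform t a b) ((-(motionCross (J.axis s) * J.transform s)) a b) s := by
  rw [J.neg_motionCross_axis_mul_transform]
  rcases a with a | a <;> rcases b with b | b
  · exact J.hasDerivAt_rot s b a
  · exact hasDerivAt_const _ _
  · simp only [Joint.transform, Matrix.fromBlocks_apply₂₁, Matrix.neg_apply, Matrix.add_apply,
      Matrix.mul_apply, Matrix.transpose_apply, ← Finset.sum_add_distrib]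
    exact (HasDerivAt.fun_sum fun c _ =>
      (J.hasDerivAt_rot s c a).mul (hasDerivAt_skew (J.hasDerivAt_pos s) c b)).fun_neg
  · exact J.hasDerivAt_rot s b a

/-- The axis already contains first derivatives of the pose, so this is where C² regularity is
spent. -/
theorem Joint.differentiable_axis (J : Joint) : Differentiable ℝ J.axis := by
  have hd : ∀ f : ℝ → ℝ, ContDiff ℝ 2 f → Differentiable ℝ (deriv f) := fun f hf =>
    (hf.iterate_deriv' 1 1).differentiable (by norm_num)
  have hr : ∀ a b, Differentiable ℝ fun t => J.rot t a b := fun a b t =>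
    (J.hasDerivAt_rot t a b).differentiableAt
  have hr' : ∀ a b, Differentiable ℝ fun t => J.rotDeriv t a b := fun a b =>
    hd _ (J.contDiff_rot a b)
  have hp' : ∀ a, Differentiable ℝ fun t => J.posDeriv t a := fun a => hd _ (J.contDiff_pos a)
  have hA : ∀ a b, Differentiable ℝ fun t => ((J.rot t)ᵀ * J.rotDeriv t) a b := fun a b => by
    simp only [Matrix.mul_apply, Matrix.transpose_apply]
    exact Differentiable.fun_sum fun c _ => (hr c a).mul (hr' c b)
  refine differentiable_pi.2 fun a => ?_
  rcases a with a | a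
  · change Differentiable ℝ fun t => unskew ((J.rot t)ᵀ * J.rotDeriv t) a
    fin_cases a <;> exact hA _ _
  · change Differentiable ℝ fun t => ((J.rot t)ᵀ *ᵥ J.posDeriv t) a
    simp only [Matrix.mulVec, dotProduct, Matrix.transpose_apply]
    exact Differentiable.fun_sum fun c _ => (hr c a).mul (hp' c)

variable {N : ℕ}

/-! ### Recursion along the tree -/

theorem Tree.induction_parent (T : Tree N) {P : Fin N → Prop}
    (h : ∀ i, (∀ p, T.parent i = some p → P p) → P i) (i : Fin N) : P i := by
  induction i using WellFoundedLT.induction with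
  | ind i ih => exact h i fun p hp => ih p (T.parent_lt i p hp)

/-- The default 0 stands for the fixed base, so bodies on the base and all others share one
recursion. -/
theorem Tree.velocity_eq (T : Tree N) (q u : Fin N → ℝ) (i : Fin N) :
    T.velocity q u i =
      T.X q i *ᵥ (T.parent i).elim 0 (T.velocity q u) + u i • T.axis q i := by
  rw [Tree.velocity]
  congr 1
  split <;> rename_i h <;> simp [h]

/-- The derivative of the body velocities at joint rates `w` when the joint coordinates move with
rates `u` and the joint axes are constant in local coordinates. -/
noncomputable def Tree.velocityDeriv (T : Tree N) (q u w : Fin N → ℝ) (i : Fin N) : SpatialVec :=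
  (match h : T.parent i with
    | none => 0
    | some p =>
      have : p < i := T.parent_lt i p h
      T.X q i *ᵥ T.velocityDeriv q u w p) -
    u i • (motionCross (T.axis q i) *ᵥ T.velocity q w i)
termination_by i

theorem Tree.velocityDeriv_eq (T : Tree N) (q u w : Fin N → ℝ) (i : Fin N) :
    T.velocityDeriv q u w i =
      T.X q i *ᵥ (T.parent i).elim 0 (T.velocityDeriv q u w) -
        u i • (motionCross (T.axis q i) *ᵥ T.velocity q w i) := by
  rw [Tree.velocityDeriv]
  congr 1
  split <;> rename_i h <;> simp [h]

/-- The matrix taking motion vectors in the frame of body `j` to the frame of body `k`, if `j` is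
`k` or an ancestor of `k`, and zero otherwise. -/
noncomputable def Tree.transport (T : Tree N) (q : Fin N → ℝ) (j k : Fin N) : SpatialMat :=
  if k = j then 1 else
    match h : T.parent k with
    | none => 0
    | some p =>
      have : p < k := T.parent_lt k p h
      T.X q k * T.transport q j p
termination_by k

theorem Tree.transport_self (T : Tree N) (q : Fin N → ℝ) (j : Fin N) :
    T.transport q j j = 1 := by
  rw [Tree.transport, if_pos rfl]

theorem Tree.transport_of_ne (T : Tree N) (q : Fin N → ℝ) {j k : Fin N} (hk : k ≠ j) :
    T.transport q j k = T.X q k * (T.parent k).elim 0 (T.transport q j) := by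
  rw [Tree.transport, if_neg hk]
  split <;> rename_i h <;> simp [h]

theorem Tree.transport_none (T : Tree N) (q : Fin N → ℝ) {j k : Fin N} (hk : k ≠ j)
    (h : T.parent k = none) : T.transport q j k = 0 := by
  simp [T.transport_of_ne q hk, h]

theorem Tree.transport_some (T : Tree N) (q : Fin N → ℝ) {j k p : Fin N} (hk : k ≠ j)
    (h : T.parent k = some p) : T.transport q j k = T.X q k * T.transport q j p := by
  simp [T.transport_of_ne q hk, h]

/-- Predecessors have smaller indices, so a body numbered before j cannot descend from j. -/
theorem Tree.transport_eq_zero_of_lt (T : Tree N) (q : Fin N → ℝ) {j : Fin N} (k : Fin N) :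
    k < j → T.transport q j k = 0 := by
  induction k using T.induction_parent with
  | h k ih =>
    intro hk
    cases h : T.parent k with
    | none => exact T.transport_none q hk.ne h
    | some p => rw [T.transport_some q hk.ne h, ih p h ((T.parent_lt k p h).trans hk), mul_zero]

theorem Tree.velocity_single (T : Tree N) (q : Fin N → ℝ) (j k : Fin N) :
    T.velocity q (Pi.single j 1) k = T.transport q j k *ᵥ T.axis q j := by
  induction k using T.induction_parent with
  | h k ih =>
    rw [T.velocity_eq]
    by_cases hk : k = j
    · subst hk
      rw [T.transport_self]
      cases h : T.parent k with
      | none => simp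
      | some p => simp [ih p h, T.transport_eq_zero_of_lt q p (T.parent_lt k p h)]
    · rw [T.transport_of_ne q hk]
      cases h : T.parent k with
      | none => simp [hk]
      | some p => simp [hk, ih p h, Matrix.mulVec_mulVec]

theorem Tree.velocity_eq_sum (T : Tree N) (q u : Fin N → ℝ) (k : Fin N) :
    T.velocity q u k = ∑ l, u l • T.velocity q (Pi.single l 1) k := by
  induction k using T.induction_parent with
  | h k ih =>
    simp only [T.velocity_eq q _ k, smul_add, Finset.sum_add_distrib, ← Matrix.mulVec_smul]
    congr 1
    · rw [← Matrix.mulVec_sum]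
      cases h : T.parent k with
      | none => simp
      | some p => simp [ih p h]
    · simp [Pi.single_apply]

theorem Tree.velocityDeriv_eq_sum (T : Tree N) (q u w : Fin N → ℝ) (k : Fin N) :
    T.velocityDeriv q u w k = ∑ l, u l • T.velocityDeriv q (Pi.single l 1) w k := by
  induction k using T.induction_parent with
  | h k ih =>
    simp only [T.velocityDeriv_eq q _ _ k, smul_sub, Finset.sum_sub_distrib,
      ← Matrix.mulVec_smul]
    congr 1
    · rw [← Matrix.mulVec_sum]
      cases h : T.parent k with
      | none => simp
      | some p => simp [ih p h]
    · rw [← Matrix.mulVec_sum]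
      simp [Pi.single_apply]

theorem Tree.X_mulVec_motionCross (T : Tree N) (q : Fin N → ℝ) (i : Fin N) (v w : SpatialVec) :
    T.X q i *ᵥ (motionCross v *ᵥ w) = motionCross (T.X q i *ᵥ v) *ᵥ (T.X q i *ᵥ w) :=
  transform_mulVec_motionCross _ _ _ _

/-- The Maurer–Cartan equation of rigid motions in body coordinates. Down the tree, X preserves the
cross product; the terms added at joint k match by antisymmetry and Φ × Φ = 0. -/
theorem Tree.velocityDeriv_sub_comm (T : Tree N) (q u w : Fin N → ℝ) (k : Fin N) :
    T.velocityDeriv q u w k - T.velocityDeriv q w u k =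
      -(motionCross (T.velocity q u k) *ᵥ T.velocity q w k) := by
  induction k using T.induction_parent with
  | h k ih =>
    have hp : (T.parent k).elim 0 (T.velocityDeriv q u w) -
        (T.parent k).elim 0 (T.velocityDeriv q w u) =
        -(motionCross ((T.parent k).elim 0 (T.velocity q u)) *ᵥ
          (T.parent k).elim 0 (T.velocity q w)) := by
      cases h : T.parent k with
      | none => simp
      | some p => simpa using ih p h
    have hX := congrArg (T.X q k *ᵥ ·) hp
    simp only [Matrix.mulVec_sub, Matrix.mulVec_neg, T.X_mulVec_motionCross] at hX
    simp only [T.velocityDeriv_eq q _ _ k, T.velocity_eq q _ k, Matrix.mulVec_add, motionCross_add,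
      Matrix.add_mulVec, motionCross_smul, Matrix.smul_mulVec, Matrix.mulVec_smul,
      motionCross_mulVec_self]
    rw [motionCross_mulVec_comm (T.X q k *ᵥ _) (T.axis q k)]
    rw [sub_eq_iff_eq_add] at hX
    rw [hX]
    module

/-- Both sides are the absolute rate of change of axis j, which is fixed in body j: directly on the
left, and on the right as seen from the moving frame of k. Outside the subtree of j both vanish. -/
theorem Tree.transport_mulVec_axisDot (T : Tree N) (q u : Fin N → ℝ) (j k : Fin N) :
    T.transport q j k *ᵥ (motionCross (T.velocity q u j) *ᵥ T.axis q j) =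
      motionCross (T.velocity q u k) *ᵥ T.velocity q (Pi.single j 1) k +
        T.velocityDeriv q u (Pi.single j 1) k := by
  induction k using T.induction_parent with
  | h k ih =>
    have hp : (T.parent k).elim 0 (fun p => T.transport q j p *ᵥ
          (motionCross (T.velocity q u j) *ᵥ T.axis q j)) =
        motionCross ((T.parent k).elim 0 (T.velocity q u)) *ᵥ
          (T.parent k).elim 0 (T.velocity q (Pi.single j 1)) +
          (T.parent k).elim 0 (T.velocityDeriv q u (Pi.single j 1)) := by
      cases h : T.parent k with
      | none => simp
      | some p => simpa using ih p h
    by_cases hk : k = j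
    · subst hk
      -- The predecessor precedes k, so the transport and the unit-rate velocity vanish there; the
      -- induction hypothesis then leaves only the derivative, which must be 0.
      have h0 : (T.parent k).elim 0 (T.velocityDeriv q u (Pi.single k 1)) = 0 := by
        cases h : T.parent k with
        | none => rfl
        | some p =>
          have h1 := ih p h
          have h2 := T.velocity_single q k p
          rw [T.transport_eq_zero_of_lt q p (T.parent_lt k p h), Matrix.zero_mulVec] at h1 h2
          simpa [h2] using h1.symm
      rw [T.velocityDeriv_eq, h0, T.velocity_single, T.transport_self, Matrix.mulVec_zero,
        Matrix.one_mulVec, Matrix.one_mulVec, motionCross_mulVec_self]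
      simp
    · have hX := congrArg (T.X q k *ᵥ ·) hp
      simp only [Matrix.mulVec_add, T.X_mulVec_motionCross] at hX
      have hl : T.transport q j k *ᵥ (motionCross (T.velocity q u j) *ᵥ T.axis q j) =
          T.X q k *ᵥ (T.parent k).elim 0 (fun p => T.transport q j p *ᵥ
            (motionCross (T.velocity q u j) *ᵥ T.axis q j)) := by
        rw [T.transport_of_ne q hk]
        cases h : T.parent k with
        | none => simp
        | some p => simp only [Option.elim_some, Matrix.mulVec_mulVec, Matrix.mul_assoc]
      rw [hl, hX, T.velocityDeriv_eq, T.velocity_eq q u k, T.velocity_eq q _ k]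
      simp only [Pi.single_eq_of_ne hk, zero_smul, add_zero, motionCross_add, motionCross_smul,
        Matrix.add_mulVec, Matrix.smul_mulVec]
      abel

/-! ### Derivatives of the velocities and of the mass matrix -/

theorem hasDerivAt_mulVec {m n : Type*} [Fintype m] [Fintype n] {A : ℝ → Matrix m n ℝ}
    {A' : Matrix m n ℝ} {v : ℝ → n → ℝ} {v' : n → ℝ} {s : ℝ}
    (hA : ∀ a b, HasDerivAt (fun t => A t a b) (A' a b) s) (hv : HasDerivAt v v' s) :
    HasDerivAt (fun t => A t *ᵥ v t) (A' *ᵥ v s + A s *ᵥ v') s := by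
  refine hasDerivAt_pi.2 fun a => ?_
  simp only [Matrix.mulVec, dotProduct, Pi.add_apply, ← Finset.sum_add_distrib]
  exact HasDerivAt.fun_sum fun b _ => (hA a b).mul (hasDerivAt_pi.1 hv b)

theorem hasDerivAt_dotProduct {n : Type*} [Fintype n] {v w : ℝ → n → ℝ} {v' w' : n → ℝ} {s : ℝ}
    (hv : HasDerivAt v v' s) (hw : HasDerivAt w w' s) :
    HasDerivAt (fun t => v t ⬝ᵥ w t) (v' ⬝ᵥ w s + v s ⬝ᵥ w') s := by
  simp only [dotProduct, ← Finset.sum_add_distrib]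
  exact HasDerivAt.fun_sum fun b _ => (hasDerivAt_pi.1 hv b).mul (hasDerivAt_pi.1 hw b)

theorem Tree.hasDerivAt_velocity (T : Tree N)
    (hT : ∀ (i : Fin N) (s : ℝ), HasDerivAt (T.joint i).axis 0 s)
    (q w : Fin N → ℝ) (l k : Fin N) :
    HasDerivAt (fun s => T.velocity (Function.update q l s) w k)
      (T.velocityDeriv q (Pi.single l 1) w k) (q l) := by
  induction k using T.induction_parent with
  | h k ih =>
    have hp : HasDerivAt
        (fun s => (T.parent k).elim 0 (T.velocity (Function.update q l s) w))
        ((T.parent k).elim 0 (T.velocityDeriv q (Pi.single l 1) w)) (q l) := by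
      cases h : T.parent k with
      | none => exact hasDerivAt_const _ _
      | some p => exact ih p h
    simp only [T.velocity_eq _ _ k]
    by_cases hk : k = l
    · subst hk
      have hX : ∀ a b, HasDerivAt (fun s => T.X (Function.update q k s) k a b)
          ((-(motionCross (T.axis q k) * T.X q k)) a b) (q k) := by
        intro a b
        simp only [Tree.X, Function.update_self]
        exact (T.joint k).hasDerivAt_transform (q k) a b
      have ha : HasDerivAt (fun s => w k • T.axis (Function.update q k s) k) 0 (q k) := by
        simp only [Tree.axis, Function.update_self]
        simpa using (hT k (q k)).fun_const_smul (w k)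
      refine ((hasDerivAt_mulVec hX hp).add ha).congr_deriv ?_
      -- The product rule gives Φ × (X v_p), the definition Φ × v_k; they agree because Φ × Φ = 0.
      rw [T.velocityDeriv_eq, T.velocity_eq q w k]
      simp only [Function.update_eq_self, Pi.single_eq_same, one_smul, Matrix.mulVec_add,
        Matrix.mulVec_smul, motionCross_mulVec_self, smul_zero, add_zero, Matrix.neg_mulVec,
        Matrix.mulVec_mulVec]
      abel
    · have hX : ∀ a b, HasDerivAt (fun s => T.X (Function.update q l s) k a b)
          ((0 : SpatialMat) a b) (q l) := by
        intro a b
        simp only [Tree.X, Function.update_of_ne hk]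
        exact hasDerivAt_const _ _
      have ha : HasDerivAt (fun s => w k • T.axis (Function.update q l s) k) 0 (q l) := by
        simp only [Tree.axis, Function.update_of_ne hk]
        exact hasDerivAt_const _ _
      refine ((hasDerivAt_mulVec hX hp).add ha).congr_deriv ?_
      rw [T.velocityDeriv_eq]
      simp [Pi.single_eq_of_ne hk]

theorem Tree.partialDeriv_massMatrix (T : Tree N)
    (hT : ∀ (i : Fin N) (s : ℝ), HasDerivAt (T.joint i).axis 0 s)
    (q : Fin N → ℝ) (i j l : Fin N) :
    partialDeriv (fun x => T.massMatrix x i j) l q = ∑ k,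
      (T.velocityDeriv q (Pi.single l 1) (Pi.single i 1) k ⬝ᵥ
          ((T.inertia k).toMat *ᵥ T.velocity q (Pi.single j 1) k) +
        T.velocity q (Pi.single i 1) k ⬝ᵥ
          ((T.inertia k).toMat *ᵥ T.velocityDeriv q (Pi.single l 1) (Pi.single j 1) k)) := by
  have hc : ∀ k (a b : Fin 3 ⊕ Fin 3), HasDerivAt (fun _ : ℝ => (T.inertia k).toMat a b)
      ((0 : SpatialMat) a b) (q l) := fun k a b => hasDerivAt_const _ _
  refine HasDerivAt.deriv ?_
  simp only [Tree.massMatrix, Matrix.of_apply]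
  refine HasDerivAt.fun_sum fun k _ => ?_
  refine (hasDerivAt_dotProduct (T.hasDerivAt_velocity hT q _ l k)
    (hasDerivAt_mulVec (hc k) (T.hasDerivAt_velocity hT q _ l k))).congr_deriv ?_
  simp

theorem Joint.differentiable_transform (J : Joint) (a b : Fin 3 ⊕ Fin 3) :
    Differentiable ℝ fun s => J.transform s a b := fun s =>
  (J.hasDerivAt_transform s a b).differentiableAt

theorem Tree.differentiable_velocity (T : Tree N) (w : Fin N → ℝ) (k : Fin N) :
    Differentiable ℝ fun q : Fin N → ℝ => T.velocity q w k := by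
  induction k using T.induction_parent with
  | h k ih =>
    have hp : Differentiable ℝ fun q => (T.parent k).elim 0 (T.velocity q w) := by
      cases h : T.parent k with
      | none => exact differentiable_const _
      | some p => exact ih p h
    have hX : ∀ a b, Differentiable ℝ fun q : Fin N → ℝ => T.X q k a b := fun a b =>
      ((T.joint k).differentiable_transform a b).comp (differentiable_apply k)
    have ha : Differentiable ℝ fun q : Fin N → ℝ => T.axis q k :=
      (T.joint k).differentiable_axis.comp (differentiable_apply k)
    simp only [T.velocity_eq _ _ k]
    refine Differentiable.add (differentiable_pi.2 fun a => ?_) (ha.fun_const_smul _)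
    simp only [Matrix.mulVec, dotProduct]
    exact Differentiable.fun_sum fun b _ => (hX a b).mul (differentiable_pi.1 hp b)

theorem Tree.differentiable_massMatrix (T : Tree N) (i j : Fin N) :
    Differentiable ℝ fun q : Fin N → ℝ => T.massMatrix q i j := by
  simp only [Tree.massMatrix, Matrix.of_apply, Matrix.mulVec, dotProduct]
  have h := fun w k => differentiable_pi.1 (T.differentiable_velocity w k)
  exact Differentiable.fun_sum fun k _ => Differentiable.fun_sum fun a _ =>
    (h _ k a).mul (Differentiable.fun_sum fun b _ => (h _ k b).const_mul _)

theorem Tree.hasDerivAt_axis (T : Tree N)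
    (hT : ∀ (i : Fin N) (q qd : Fin N → ℝ), T.axisRate q qd i = 0) (i : Fin N) (s : ℝ) :
    HasDerivAt (T.joint i).axis 0 s := by
  -- Unit rates turn the axis rate into `deriv` itself. A zero `deriv` says something only together
  -- with the differentiability of the axis.
  have h := hT i (fun _ => s) (fun _ => 1)
  rw [Tree.axisRate, one_smul] at h
  exact h ▸ ((T.joint i).differentiable_axis s).hasDerivAt

/-! ### The Christoffel-consistent factorization as a sum over the bodies -/

theorem dotProduct_mulVec_comm_of_symm {n : Type*} [Fintype n] {I : Matrix n n ℝ} (hI : Iᵀ = I)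
    (x y : n → ℝ) : x ⬝ᵥ (I *ᵥ y) = y ⬝ᵥ (I *ᵥ x) := by
  rw [Matrix.dotProduct_mulVec, ← Matrix.mulVec_transpose, hI, dotProduct_comm]

theorem dotProduct_forceCross_mulVec (x v f : SpatialVec) :
    x ⬝ᵥ (forceCross v *ᵥ f) = -((motionCross v *ᵥ x) ⬝ᵥ f) := by
  rw [forceCross, Matrix.neg_mulVec, dotProduct_neg, Matrix.dotProduct_mulVec,
    Matrix.vecMul_transpose]

/-- Expresses B through motion cross products only, the form in which Christoffel terms can be
compared. -/
theorem dotProduct_niemeyerSlotine (x y v : SpatialVec) (I : SpatialMat) :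
    x ⬝ᵥ (niemeyerSlotine v I *ᵥ y) =
      (1 / 2) * (-((motionCross v *ᵥ x) ⬝ᵥ (I *ᵥ y)) - (motionCross y *ᵥ x) ⬝ᵥ (I *ᵥ v) -
        x ⬝ᵥ (I *ᵥ (motionCross v *ᵥ y))) := by
  rw [niemeyerSlotine, Matrix.smul_mulVec, dotProduct_smul, Matrix.sub_mulVec, Matrix.add_mulVec,
    forceBarCross_mulVec, ← Matrix.mulVec_mulVec, ← Matrix.mulVec_mulVec, dotProduct_sub,
    dotProduct_add, dotProduct_forceCross_mulVec, dotProduct_forceCross_mulVec, smul_eq_mul]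
  ring

/-- The Coriolis matrix obtained by adding up the body-level factorizations `B`. -/
noncomputable def Tree.bodySum (T : Tree N) (q : Fin N → ℝ) (B : Fin N → SpatialMat)
    (axisDot : Fin N → SpatialVec) (i j : Fin N) : ℝ :=
  ∑ k, (T.transport q i k *ᵥ T.axis q i) ⬝ᵥ
    ((T.inertia k).toMat *ᵥ (T.transport q j k *ᵥ axisDot j) +
      B k *ᵥ (T.transport q j k *ᵥ T.axis q j))

theorem Tree.christoffel_eq_sum (T : Tree N)
    (hT : ∀ (i : Fin N) (s : ℝ), HasDerivAt (T.joint i).axis 0 s)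
    (q : Fin N → ℝ) (i j l : Fin N) :
    T.christoffel q i j l = ∑ k,
      (T.velocity q (Pi.single i 1) k ⬝ᵥ ((T.inertia k).toMat *ᵥ
        (motionCross (T.velocity q (Pi.single l 1) k) *ᵥ T.velocity q (Pi.single j 1) k +
          T.velocityDeriv q (Pi.single l 1) (Pi.single j 1) k)) +
      T.velocity q (Pi.single i 1) k ⬝ᵥ
        (niemeyerSlotine (T.velocity q (Pi.single l 1) k) (T.inertia k).toMat *ᵥ
          T.velocity q (Pi.single j 1) k)) := by
  rw [Tree.christoffel, T.partialDeriv_massMatrix hT, T.partialDeriv_massMatrix hT,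
    T.partialDeriv_massMatrix hT, ← Finset.sum_add_distrib, ← Finset.sum_sub_distrib,
    Finset.mul_sum]
  refine Finset.sum_congr rfl fun k _ => ?_
  rw [dotProduct_niemeyerSlotine]
  have hI := (T.inertia k).toMat_transpose
  have h₁ := T.velocityDeriv_sub_comm q (Pi.single l 1) (Pi.single i 1) k
  have h₂ := T.velocityDeriv_sub_comm q (Pi.single j 1) (Pi.single i 1) k
  have h₃ := T.velocityDeriv_sub_comm q (Pi.single j 1) (Pi.single l 1) k
  rw [motionCross_mulVec_comm, neg_neg] at h₃
  -- After these exchanges every derivative is along q_i or is D_l J_j. The former cancel by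
  -- symmetry of the inertia; the latter occurs twice, absorbing the factor ½.
  rw [sub_eq_iff_eq_add] at h₁ h₂ h₃
  rw [h₁, h₂, h₃, dotProduct_mulVec_comm_of_symm hI (T.velocity q (Pi.single j 1) k)
    (T.velocityDeriv q (Pi.single i 1) (Pi.single l 1) k)]
  simp only [Matrix.mulVec_add, dotProduct_add, add_dotProduct, neg_dotProduct]
  ring

/-- Velocity, its derivative and B are linear in the rates, so summing the symbols against `qd`
replaces unit rates by the actual motion. -/
theorem Tree.christoffelCoriolis_apply (T : Tree N)
    (hT : ∀ (i : Fin N) (s : ℝ), HasDerivAt (T.joint i).axis 0 s)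
    (q qd : Fin N → ℝ) (i j : Fin N) :
    T.christoffelCoriolis q qd i j =
      T.bodySum q (fun k => niemeyerSlotine (T.velocity q qd k) (T.inertia k).toMat)
        (fun k => motionCross (T.velocity q qd k) *ᵥ T.axis q k) i j := by
  simp only [Tree.christoffelCoriolis, Matrix.of_apply, Tree.bodySum, T.christoffel_eq_sum hT,
    Finset.sum_mul]
  rw [Finset.sum_comm]
  refine Finset.sum_congr rfl fun k _ => ?_
  rw [T.transport_mulVec_axisDot, ← T.velocity_single, ← T.velocity_single, dotProduct_add,
    dotProduct_niemeyerSlotine]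
  have hV : ∀ x : SpatialVec, motionCross (T.velocity q qd k) *ᵥ x =
      ∑ l, qd l • (motionCross (T.velocity q (Pi.single l 1) k) *ᵥ x) := fun x => by
    rw [motionCross_mulVec_comm, T.velocity_eq_sum, Matrix.mulVec_sum, ← Finset.sum_neg_distrib]
    refine Finset.sum_congr rfl fun l _ => ?_
    rw [Matrix.mulVec_smul, motionCross_mulVec_comm x, smul_neg, neg_neg]
  rw [T.velocityDeriv_eq_sum, hV, hV, T.velocity_eq_sum q qd]
  simp only [Matrix.mulVec_add, dotProduct_add, Matrix.mulVec_sum, dotProduct_sum, sum_dotProduct,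
    Matrix.mulVec_smul, dotProduct_smul, smul_dotProduct, smul_eq_mul, dotProduct_niemeyerSlotine,
    ← Finset.sum_neg_distrib, ← Finset.sum_sub_distrib, ← Finset.sum_add_distrib, Finset.mul_sum]
  exact Finset.sum_congr rfl fun l _ => by ring

/-! ### Ancestors -/

/-- `T.Step k p` means that `p` is the predecessor of `k`. -/
def Tree.Step (T : Tree N) (k p : Fin N) : Prop := T.parent k = some p

theorem Tree.step_rightUnique (T : Tree N) : Relator.RightUnique T.Step := fun a b c hb hc => by
  rw [Tree.Step] at hb hc
  exact Option.some_injective _ (hb.symm.trans hc)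

theorem Tree.lt_of_transGen (T : Tree N) {k a : Fin N} (h : Relation.TransGen T.Step k a) :
    a < k := by
  induction h with
  | single h => exact T.parent_lt _ _ h
  | tail _ h ih => exact (T.parent_lt _ _ h).trans ih

theorem Tree.transGen_iff (T : Tree N) {k p : Fin N} (h : T.parent k = some p) (a : Fin N) :
    Relation.TransGen T.Step k a ↔ a = p ∨ Relation.TransGen T.Step p a := by
  rw [Relation.TransGen.head'_iff]
  constructor
  · rintro ⟨b, hb, hr⟩
    obtain rfl := T.step_rightUnique hb h
    exact Relation.reflTransGen_iff_eq_or_transGen.1 hr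
  · exact fun ha => ⟨p, h, Relation.reflTransGen_iff_eq_or_transGen.2 ha⟩

theorem Tree.not_transGen_of_none (T : Tree N) {k : Fin N} (h : T.parent k = none) (a : Fin N) :
    ¬ Relation.TransGen T.Step k a := by
  rw [Relation.TransGen.head'_iff]
  rintro ⟨b, hb, -⟩
  rw [Tree.Step, h] at hb
  exact absurd hb (by simp)

theorem Tree.reflTransGen_of_transport_ne_zero (T : Tree N) (q : Fin N → ℝ) (j k : Fin N) :
    T.transport q j k ≠ 0 → Relation.ReflTransGen T.Step k j := by
  induction k using T.induction_parent with
  | h k ih =>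
    intro h0
    by_cases hk : k = j
    · exact hk ▸ Relation.ReflTransGen.refl
    cases h : T.parent k with
    | none => exact absurd (T.transport_none q hk h) h0
    | some p =>
      rw [T.transport_some q hk h] at h0
      exact Relation.ReflTransGen.head h (ih p h (right_ne_zero_of_mul h0))

/-- Nonvanishing serves as the condition that k lies in the subtree of j; elsewhere the left side is
0 while the right side need not be. -/
theorem Tree.transport_mul_transport (T : Tree N) (q : Fin N → ℝ) {i j : Fin N}
    (hij : Relation.TransGen T.Step j i) (k : Fin N) :
    T.transport q j k ≠ 0 → T.transport q j k * T.transport q i j = T.transport q i k := by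
  induction k using T.induction_parent with
  | h k ih =>
    intro h0
    by_cases hk : k = j
    · subst hk
      rw [T.transport_self, one_mul]
    cases h : T.parent k with
    | none => exact absurd (T.transport_none q hk h) h0
    | some p =>
      have hki : k ≠ i := by
        rcases Relation.reflTransGen_iff_eq_or_transGen.1
          (T.reflTransGen_of_transport_ne_zero q j k h0) with e | e
        · exact absurd e.symm hk
        · exact ((T.lt_of_transGen hij).trans (T.lt_of_transGen e)).ne'
      rw [T.transport_some q hk h] at h0
      rw [T.transport_some q hk h, T.transport_some q hki h, mul_assoc,
        ih p h (right_ne_zero_of_mul h0)]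

/-- The ancestors of k form a chain: were i and j both on it, i < j would put i above j. -/
theorem Tree.transport_eq_zero_or (T : Tree N) (q : Fin N → ℝ) {i j : Fin N} (hij : i < j)
    (h : ¬ Relation.TransGen T.Step j i) (k : Fin N) :
    T.transport q i k = 0 ∨ T.transport q j k = 0 := by
  by_contra! hne
  have hi := T.reflTransGen_of_transport_ne_zero q i k hne.1
  have hj := T.reflTransGen_of_transport_ne_zero q j k hne.2
  rcases Relation.ReflTransGen.total_of_right_unique T.step_rightUnique hi hj with e | e
  · rcases Relation.reflTransGen_iff_eq_or_transGen.1 e with e | e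
    · exact hij.ne' e
    · exact hij.not_gt (T.lt_of_transGen e)
  · rcases Relation.reflTransGen_iff_eq_or_transGen.1 e with e | e
    · exact hij.ne e
    · exact h e

/-! ### Composite operators -/

/-- The sum over the subtree of body `j` of operators `A k` on the bodies, in the frame of `j`. -/
noncomputable def Tree.composite (T : Tree N) (q : Fin N → ℝ) (A : Fin N → SpatialMat)
    (j : Fin N) : SpatialMat :=
  ∑ k, (T.transport q j k)ᵀ * A k * T.transport q j k

/-- The path from k up to j enters j through exactly one child c, and only that term survives. If k
is not below j, both sides are 0. -/
theorem Tree.transport_congruence (T : Tree N) (q : Fin N → ℝ) {j : Fin N} (k : Fin N) :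
    k ≠ j → ∀ A : SpatialMat, (T.transport q j k)ᵀ * A * T.transport q j k =
      ∑ c, if T.parent c = some j then
        (T.X q c)ᵀ * ((T.transport q c k)ᵀ * A * T.transport q c k) * T.X q c else 0 := by
  induction k using T.induction_parent with
  | h k ih =>
    intro hk A
    cases h : T.parent k with
    | none =>
      rw [T.transport_none q hk h, Finset.sum_eq_zero]
      · simp
      · intro c _
        split_ifs with hc
        · have hkc : k ≠ c := by
            rintro rfl
            rw [h] at hc
            exact absurd hc (by simp)
          simp [T.transport_none q hkc h]
        · rfl
    | some p =>
      rw [T.transport_some q hk h]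
      by_cases hp : p = j
      · subst hp
        rw [Finset.sum_eq_single k]
        · simp [h, T.transport_self]
        · intro c _ hck
          split_ifs with hc
          · rw [T.transport_some q hck.symm h, T.transport_eq_zero_of_lt q p (T.parent_lt c p hc)]
            simp
          · rfl
        · simp
      -- The operator is general so that it can be pulled back to the predecessor here.
      · have := ih p h hp ((T.X q k)ᵀ * A * T.X q k)
        simp only [Matrix.transpose_mul, Matrix.mul_assoc] at this ⊢
        rw [this]
        refine Finset.sum_congr rfl fun c _ => ?_
        split_ifs with hc
        · have hkc : k ≠ c := by
            rintro rfl
            exact hp (Option.some_injective _ (h.symm.trans hc))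
          simp only [T.transport_some q hkc h, Matrix.transpose_mul, Matrix.mul_assoc]
        · rfl

theorem Tree.composite_eq (T : Tree N) (q : Fin N → ℝ) (A : Fin N → SpatialMat) (j : Fin N) :
    T.composite q A j = A j + ∑ c, if T.parent c = some j then
      (T.X q c)ᵀ * T.composite q A c * T.X q c else 0 := by
  have h : ∀ k, (T.transport q j k)ᵀ * A k * T.transport q j k = (if k = j then A k else 0) +
      ∑ c, if T.parent c = some j then
        (T.X q c)ᵀ * ((T.transport q c k)ᵀ * A k * T.transport q c k) * T.X q c else 0 := by
    intro k
    by_cases hk : k = j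
    · subst hk
      rw [if_pos rfl, T.transport_self, Finset.sum_eq_zero]
      · simp
      · intro c _
        split_ifs with hc
        · simp [T.transport_eq_zero_of_lt q k (T.parent_lt c k hc)]
        · rfl
    · rw [if_neg hk, zero_add, T.transport_congruence q k hk]
  rw [Tree.composite, Finset.sum_congr rfl fun k _ => h k, Finset.sum_add_distrib,
    Finset.sum_comm]
  congr 1
  · simp
  · refine Finset.sum_congr rfl fun c _ => ?_
    split_ifs with hc
    · rw [Tree.composite, Matrix.mul_sum, Matrix.sum_mul]
    · simp

theorem Tree.composite_transpose (T : Tree N) (q : Fin N → ℝ) {A : Fin N → SpatialMat}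
    (hA : ∀ k, (A k)ᵀ = A k) (j : Fin N) : (T.composite q A j)ᵀ = T.composite q A j := by
  simp [Tree.composite, Matrix.transpose_sum, Matrix.transpose_mul, hA, Matrix.mul_assoc]

theorem Tree.dotProduct_composite_mulVec (T : Tree N) (q : Fin N → ℝ) (A : Fin N → SpatialMat)
    (j : Fin N) (x y : SpatialVec) : x ⬝ᵥ (T.composite q A j *ᵥ y) =
      ∑ k, (T.transport q j k *ᵥ x) ⬝ᵥ (A k *ᵥ (T.transport q j k *ᵥ y)) := by
  rw [Tree.composite, Matrix.sum_mulVec, dotProduct_sum]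
  refine Finset.sum_congr rfl fun k _ => ?_
  rw [← Matrix.mulVec_mulVec, ← Matrix.mulVec_mulVec, Matrix.dotProduct_mulVec x,
    Matrix.vecMul_transpose]

section BodySum

variable (T : Tree N) (q : Fin N → ℝ) (B : Fin N → SpatialMat) (axisDot : Fin N → SpatialVec)

theorem Tree.bodySum_self (j : Fin N) : T.bodySum q B axisDot j j =
    T.axis q j ⬝ᵥ (T.composite q (fun k => (T.inertia k).toMat) j *ᵥ axisDot j +
      T.composite q B j *ᵥ T.axis q j) := by
  rw [dotProduct_add, T.dotProduct_composite_mulVec, T.dotProduct_composite_mulVec,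
    ← Finset.sum_add_distrib]
  simp only [Tree.bodySum, dotProduct_add]

/-- In a body sum, the summand of k either drops out or factors through the frame of j. -/
theorem Tree.transport_mulVec_of_transGen {i j : Fin N} (hij : Relation.TransGen T.Step j i)
    (k : Fin N) : T.transport q j k = 0 ∨ ∀ x : SpatialVec,
      T.transport q i k *ᵥ x = T.transport q j k *ᵥ (T.transport q i j *ᵥ x) := by
  refine or_iff_not_imp_left.2 fun h0 x => ?_
  rw [Matrix.mulVec_mulVec, T.transport_mul_transport q hij k h0]

theorem Tree.bodySum_ancestor_left {i j : Fin N} (hij : Relation.TransGen T.Step j i) :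
    T.bodySum q B axisDot i j = (T.transport q i j *ᵥ T.axis q i) ⬝ᵥ
      (T.composite q (fun k => (T.inertia k).toMat) j *ᵥ axisDot j +
        T.composite q B j *ᵥ T.axis q j) := by
  rw [dotProduct_add, T.dotProduct_composite_mulVec, T.dotProduct_composite_mulVec,
    ← Finset.sum_add_distrib]
  refine Finset.sum_congr rfl fun k _ => ?_
  rcases T.transport_mulVec_of_transGen q hij k with h | h
  · simp [h]
  · rw [h, dotProduct_add]

theorem Tree.bodySum_ancestor_right {i j : Fin N} (hij : Relation.TransGen T.Step j i) :
    T.bodySum q B axisDot j i = T.axis q j ⬝ᵥ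
      (T.composite q (fun k => (T.inertia k).toMat) j *ᵥ (T.transport q i j *ᵥ axisDot i) +
        T.composite q B j *ᵥ (T.transport q i j *ᵥ T.axis q i)) := by
  rw [dotProduct_add, T.dotProduct_composite_mulVec, T.dotProduct_composite_mulVec,
    ← Finset.sum_add_distrib]
  refine Finset.sum_congr rfl fun k _ => ?_
  rcases T.transport_mulVec_of_transGen q hij k with h | h
  · simp [h]
  · rw [h, h, dotProduct_add]

theorem Tree.bodySum_eq_zero {i j : Fin N}
    (h : ∀ k, T.transport q i k = 0 ∨ T.transport q j k = 0) :
    T.bodySum q B axisDot i j = 0 := by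
  refine Finset.sum_eq_zero fun k _ => ?_
  rcases h k with h | h <;> simp [h]

end BodySum

/-! ### The loops of the algorithm -/

theorem foldl_finRange_induction {α : Type*} (f : α → Fin N → α) (P : ℕ → α → Prop)
    (step : ∀ (i : Fin N) σ, P i σ → P (i + 1) (f σ i)) {σ : α} (h0 : P 0 σ) :
    P N ((List.finRange N).foldl f σ) := by
  have key : ∀ m ≤ N, P m (((List.finRange N).take m).foldl f σ) := by
    intro m
    induction m with
    | zero => exact fun _ => by simpa using h0
    | succ m ih =>
      intro hm
      have hm' : m < (List.finRange N).length := by simpa using hm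
      rw [List.take_succ_eq_append_getElem hm', List.foldl_append]
      simpa using step ⟨m, hm⟩ _ (ih (Nat.le_of_succ_le hm))
  have h := key N le_rfl
  rwa [List.take_of_length_le (by simp)] at h

/-- Here `P m` describes the state once the indices from m on are processed, so the index descends
from N to 0. -/
theorem foldl_reverse_finRange_induction {α : Type*} (f : α → Fin N → α) (P : ℕ → α → Prop)
    (step : ∀ (i : Fin N) σ, P (i + 1) σ → P i (f σ i)) {σ : α} (h0 : P N σ) :
    P 0 ((List.finRange N).reverse.foldl f σ) := by
  have key : ∀ d ≤ N, P (N - d) (((List.finRange N).drop (N - d)).reverse.foldl f σ) := by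
    intro d
    induction d with
    | zero => exact fun _ => by simpa [List.drop_of_length_le] using h0
    | succ d ih =>
      intro hd
      have hm : N - (d + 1) < N := by omega
      have hm' : N - (d + 1) < (List.finRange N).length := by simpa using hm
      rw [List.drop_eq_getElem_cons hm', List.reverse_cons, List.foldl_append]
      have e : N - (d + 1) + 1 = N - d := by omega
      have := step ⟨N - (d + 1), hm⟩ _ (e ▸ ih (Nat.le_of_succ_le hd))
      simpa using this
  simpa using key N le_rfl

/-- The variables of the forward loop have their final values for the bodies before `m`. -/
structure Tree.ForwardInv (T : Tree N) (B : SpatialVec → SpatialMat → SpatialMat)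
    (q qd : Fin N → ℝ) (m : ℕ) (σ : State N) : Prop where
  v_none : σ.v none = 0
  v : ∀ k : Fin N, k < m → σ.v (some k) = T.velocity q qd k
  axisDot : ∀ k : Fin N, k < m →
    σ.axisDot k = motionCross (T.velocity q qd k) *ᵥ T.axis q k + T.axisRate q qd k
  IC : ∀ k : Fin N, k < m → σ.IC (some k) = (T.inertia k).toMat
  BC : ∀ k : Fin N, k < m → σ.BC (some k) = B (T.velocity q qd k) (T.inertia k).toMat
  C : σ.C = 0

theorem Tree.forwardInv_step (T : Tree N) (B : SpatialVec → SpatialMat → SpatialMat)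
    (q qd : Fin N → ℝ) (i : Fin N) (σ : State N) (h : T.ForwardInv B q qd i σ) :
    T.ForwardInv B q qd (i + 1) (T.forwardStep B q qd σ i) := by
  have hv : T.X q i *ᵥ σ.v (T.parent i) + qd i • T.axis q i = T.velocity q qd i := by
    rw [T.velocity_eq]
    congr 2
    cases hp : T.parent i with
    | none => exact h.v_none
    | some p => exact h.v p (T.parent_lt i p hp)
  have hlt : ∀ k : Fin N, (k : ℕ) < i + 1 → k ≠ i → (k : ℕ) < i := fun k hk hne => by
    have : (k : ℕ) ≠ i := fun e => hne (Fin.ext e)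
    omega
  have hne : ∀ k : Fin N, k ≠ i → (some k : Option (Fin N)) ≠ some i := fun k hk e =>
    hk (Option.some_injective _ e)
  refine ⟨?_, fun k hk => ?_, fun k hk => ?_, fun k hk => ?_, fun k hk => ?_, h.C⟩
  · simp [Tree.forwardStep, h.v_none]
  all_goals
    simp only [Tree.forwardStep, hv]
    by_cases hki : k = i
    · subst hki
      simp only [Function.update_self]
  · rw [Function.update_of_ne (hne k hki), h.v k (hlt k hk hki)]
  · rw [Function.update_of_ne hki, h.axisDot k (hlt k hk hki)]
  · rw [Function.update_of_ne (hne k hki), h.IC k (hlt k hk hki)]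
  · rw [Function.update_of_ne (hne k hki), h.BC k (hlt k hk hki)]

theorem Tree.forwardInv_foldl (T : Tree N) (B : SpatialVec → SpatialMat → SpatialMat)
    (q qd : Fin N → ℝ) :
    T.ForwardInv B q qd N ((List.finRange N).foldl (T.forwardStep B q qd) State.init) :=
  foldl_finRange_induction _ (T.ForwardInv B q qd) (T.forwardInv_step B q qd)
    ⟨rfl, fun _ h => absurd h (Nat.not_lt_zero _), fun _ h => absurd h (Nat.not_lt_zero _),
      fun _ h => absurd h (Nat.not_lt_zero _), fun _ h => absurd h (Nat.not_lt_zero _), rfl⟩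

theorem Tree.innerLoop_none (T : Tree N) (q : Fin N → ℝ) (j : Fin N) {i : Fin N}
    (F₁ F₂ F₃ : SpatialVec) (σ : State N) (h : T.parent i = none) :
    T.innerLoop q j i F₁ F₂ F₃ σ = σ := by
  rw [Tree.innerLoop]
  split
  · rfl
  · rename_i h'
    rw [h] at h'
    exact absurd h' (by simp)

/-- The state after the inner loop has assigned the entries at `(p, j)` and `(j, p)`, from the
force vectors in the frame of `p`. -/
noncomputable def Tree.setEntries (T : Tree N) (q : Fin N → ℝ) (j p : Fin N)
    (G₁ G₂ G₃ : SpatialVec) (σ : State N) : State N :=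
  { σ with
    C := setEntry (setEntry σ.C p j (T.axis q p ⬝ᵥ G₁)) j p
      (σ.axisDot p ⬝ᵥ G₂ + T.axis q p ⬝ᵥ G₃)
    M := setEntry (setEntry σ.M p j (T.axis q p ⬝ᵥ G₂)) j p (T.axis q p ⬝ᵥ G₂)
    Mdot := setEntry (setEntry σ.Mdot p j (σ.axisDot p ⬝ᵥ G₂ + T.axis q p ⬝ᵥ (G₁ + G₃))) j p
      (σ.axisDot p ⬝ᵥ G₂ + T.axis q p ⬝ᵥ (G₁ + G₃)) }

theorem Tree.innerLoop_some (T : Tree N) (q : Fin N → ℝ) (j : Fin N) {i p : Fin N}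
    (F₁ F₂ F₃ : SpatialVec) (σ : State N) (h : T.parent i = some p) :
    T.innerLoop q j i F₁ F₂ F₃ σ =
      T.innerLoop q j p ((T.X q i)ᵀ *ᵥ F₁) ((T.X q i)ᵀ *ᵥ F₂) ((T.X q i)ᵀ *ᵥ F₃)
        (T.setEntries q j p ((T.X q i)ᵀ *ᵥ F₁) ((T.X q i)ᵀ *ᵥ F₂) ((T.X q i)ᵀ *ᵥ F₃) σ) := by
  rw [Tree.innerLoop]
  split
  · rename_i h'
    rw [h] at h'
    exact absurd h' (by simp)
  · rename_i p' h'
    obtain rfl : p = p' := Option.some_injective _ (h.symm.trans h')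
    rfl

theorem Tree.innerLoop_frame (T : Tree N) (q : Fin N → ℝ) (j : Fin N) (i : Fin N) :
    ∀ (F₁ F₂ F₃ : SpatialVec) (σ : State N),
      (T.innerLoop q j i F₁ F₂ F₃ σ).axisDot = σ.axisDot ∧
      (T.innerLoop q j i F₁ F₂ F₃ σ).IC = σ.IC ∧ (T.innerLoop q j i F₁ F₂ F₃ σ).BC = σ.BC := by
  induction i using T.induction_parent with
  | h i ih =>
    intro F₁ F₂ F₃ σ
    cases h : T.parent i with
    | none => simp [T.innerLoop_none q j F₁ F₂ F₃ σ h]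
    | some p =>
      rw [T.innerLoop_some q j F₁ F₂ F₃ σ h]
      exact ih p h _ _ _ _

-- `G` is the intended result. Its hypotheses survive a pass of the loop because transposing X moves
-- it from the force onto the transported axis.
open Classical in
theorem Tree.innerLoop_C (T : Tree N) (q : Fin N → ℝ) (j : Fin N) (G : Matrix (Fin N) (Fin N) ℝ)
    (i : Fin N) : ∀ (F₁ F₂ F₃ : SpatialVec) (σ : State N), i ≤ j →
      (∀ a, Relation.TransGen T.Step i a →
        G a j = (T.transport q a i *ᵥ T.axis q a) ⬝ᵥ F₁ ∧
        G j a = (T.transport q a i *ᵥ σ.axisDot a) ⬝ᵥ F₂ +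
          (T.transport q a i *ᵥ T.axis q a) ⬝ᵥ F₃) →
      ∀ a b, (T.innerLoop q j i F₁ F₂ F₃ σ).C a b =
        if (b = j ∧ Relation.TransGen T.Step i a) ∨ (a = j ∧ Relation.TransGen T.Step i b)
        then G a b else σ.C a b := by
  induction i using T.induction_parent with
  | h i ih =>
    intro F₁ F₂ F₃ σ hij hG a b
    cases h : T.parent i with
    | none => simp [T.innerLoop_none q j F₁ F₂ F₃ σ h, T.not_transGen_of_none h]
    | some p =>
      have hpi := T.parent_lt i p h
      have hpj : p < j := hpi.trans_le hij
      have hX : ∀ (a : Fin N) (x F : SpatialVec), Relation.TransGen T.Step i a →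
          (T.transport q a i *ᵥ x) ⬝ᵥ F = (T.transport q a p *ᵥ x) ⬝ᵥ ((T.X q i)ᵀ *ᵥ F) := by
        intro a x F ha
        rw [T.transport_some q (T.lt_of_transGen ha).ne' h, ← Matrix.mulVec_mulVec,
          Matrix.dotProduct_mulVec, Matrix.vecMul_transpose]
      have hpp : Relation.TransGen T.Step i p := (T.transGen_iff h p).2 (Or.inl rfl)
      rw [T.innerLoop_some q j F₁ F₂ F₃ σ h, ih p h _ _ _ _ hpj.le]
      · have hp := hG p hpp
        rw [hX p _ _ hpp, hX p _ _ hpp, hX p _ _ hpp, T.transport_self, Matrix.one_mulVec,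
          Matrix.one_mulVec] at hp
        simp only [T.transGen_iff h, Tree.setEntries, setEntry, Matrix.of_apply, ← hp.1, ← hp.2]
        by_cases h1 : (b = j ∧ Relation.TransGen T.Step p a) ∨
            (a = j ∧ Relation.TransGen T.Step p b)
        · rw [if_pos h1, if_pos (by tauto)]
        · rw [if_neg h1]
          by_cases h2 : a = j ∧ b = p
          · rw [if_pos h2, if_pos (by tauto), h2.1, h2.2]
          · rw [if_neg h2]
            by_cases h3 : a = p ∧ b = j
            · rw [if_pos h3, if_pos (by tauto), h3.1, h3.2]
            · rw [if_neg h3, if_neg (by tauto)]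
      · intro a ha
        have hia : Relation.TransGen T.Step i a := (T.transGen_iff h a).2 (Or.inr ha)
        have := hG a hia
        rwa [hX a _ _ hia, hX a _ _ hia, hX a _ _ hia] at this

/-- The state of the backward loop when the bodies from `m` on have been processed. -/
structure Tree.BackwardInv (T : Tree N) (q : Fin N → ℝ) (B : Fin N → SpatialMat)
    (axisDot : Fin N → SpatialVec) (m : ℕ) (σ : State N) : Prop where
  axisDot_eq : σ.axisDot = axisDot
  IC : ∀ k : Fin N, σ.IC (some k) = (T.inertia k).toMat +
    ∑ c : Fin N, if T.parent c = some k ∧ m ≤ c then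
      (T.X q c)ᵀ * T.composite q (fun k => (T.inertia k).toMat) c * T.X q c else 0
  BC : ∀ k : Fin N, σ.BC (some k) = B k +
    ∑ c : Fin N, if T.parent c = some k ∧ m ≤ c then
      (T.X q c)ᵀ * T.composite q B c * T.X q c else 0
  C : ∀ a b : Fin N, σ.C a b =
    if m ≤ a ∨ m ≤ b then T.bodySum q B axisDot a b else 0

/-- All children of j have larger indices, so its accumulated sum is complete when j is reached. -/
theorem Tree.composite_eq_of_partial (T : Tree N) (q : Fin N → ℝ) (A : Fin N → SpatialMat)
    (j : Fin N) : A j + (∑ c : Fin N, if T.parent c = some j ∧ (j : ℕ) + 1 ≤ c then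
      (T.X q c)ᵀ * T.composite q A c * T.X q c else 0) = T.composite q A j := by
  rw [T.composite_eq]
  congr 1
  refine Finset.sum_congr rfl fun c _ => if_congr ?_ rfl rfl
  exact ⟨fun h => h.1, fun h => ⟨h, T.parent_lt c j h⟩⟩

theorem Tree.partial_composite_step (T : Tree N) (A Y : Fin N → SpatialMat)
    (W : Option (Fin N) → SpatialMat) (j : Fin N)
    (hW : ∀ k : Fin N, W (some k) =
      A k + ∑ c : Fin N, if T.parent c = some k ∧ (j : ℕ) + 1 ≤ c then Y c else 0)
    (k : Fin N) : Function.update W (T.parent j) (W (T.parent j) + Y j) (some k) =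
      A k + ∑ c : Fin N, if T.parent c = some k ∧ (j : ℕ) ≤ c then Y c else 0 := by
  have hs : (∑ c : Fin N, if T.parent c = some k ∧ (j : ℕ) ≤ c then Y c else 0) =
      (∑ c : Fin N, if T.parent c = some k ∧ (j : ℕ) + 1 ≤ c then Y c else 0) +
        if T.parent j = some k then Y j else 0 := by
    have hj := Finset.sum_ite_eq' Finset.univ j fun c => if T.parent c = some k then Y c else 0
    rw [if_pos (Finset.mem_univ j)] at hj
    rw [← hj, ← Finset.sum_add_distrib]
    refine Finset.sum_congr rfl fun c _ => ?_
    by_cases hc : c = j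
    · subst hc
      simp
    · have hne : (c : ℕ) ≠ j := fun e => hc (Fin.ext e)
      have hiff : (j : ℕ) ≤ c ↔ (j : ℕ) + 1 ≤ c := by omega
      simp only [if_neg hc, add_zero, hiff]
  rw [hs]
  by_cases h : T.parent j = some k
  · rw [h, Function.update_self, if_pos rfl, hW, add_assoc]
  · rw [Function.update_of_ne (Ne.symm h), if_neg h, hW, add_zero]

/-- Step j finishes the entries whose larger index is j. Those at ancestors of j are written; the
unrelated ones keep their initial 0, which is their correct value. -/
theorem Tree.backwardInv_step (T : Tree N) (q : Fin N → ℝ) (B : Fin N → SpatialMat)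
    (axisDot : Fin N → SpatialVec) (j : Fin N) (σ : State N)
    (h : T.BackwardInv q B axisDot (j + 1) σ) :
    T.BackwardInv q B axisDot j (T.backwardStep q σ j) := by
  have hI : σ.IC (some j) = T.composite q (fun k => (T.inertia k).toMat) j := by
    rw [h.IC, T.composite_eq_of_partial q (fun k => (T.inertia k).toMat)]
  have hB : σ.BC (some j) = T.composite q B j := by
    rw [h.BC, T.composite_eq_of_partial]
  refine ⟨?_, fun k => ?_, fun k => ?_, fun a b => ?_⟩
  · simp only [Tree.backwardStep]
    rw [(T.innerLoop_frame q j j _ _ _ _).1, h.axisDot_eq]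
  · simp only [Tree.backwardStep]
    rw [(T.innerLoop_frame q j j _ _ _ _).2.1]
    simp only [hI]
    exact T.partial_composite_step _ (fun c => (T.X q c)ᵀ * T.composite q _ c * T.X q c)
      σ.IC j h.IC k
  · simp only [Tree.backwardStep]
    rw [(T.innerLoop_frame q j j _ _ _ _).2.2]
    simp only [hB]
    exact T.partial_composite_step _ (fun c => (T.X q c)ᵀ * T.composite q _ c * T.X q c)
      σ.BC j h.BC k
  · have hIs := T.composite_transpose q (fun k => (T.inertia k).toMat_transpose) j
    simp only [Tree.backwardStep, hI, hB]
    rw [T.innerLoop_C q j (Matrix.of (T.bodySum q B axisDot)) j _ _ _ _ le_rfl]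
    · simp only [Matrix.of_apply, setEntry, h.axisDot_eq, h.C, ← T.bodySum_self q B axisDot j]
      have h0 : ∀ {i : Fin N}, i < j → ¬ Relation.TransGen T.Step j i →
          T.bodySum q B axisDot i j = 0 ∧ T.bodySum q B axisDot j i = 0 := fun hi hn =>
        ⟨T.bodySum_eq_zero q B axisDot (T.transport_eq_zero_or q hi hn),
          T.bodySum_eq_zero q B axisDot fun k => (T.transport_eq_zero_or q hi hn k).symm⟩
      have hlt : ∀ {c : Fin N}, ¬ (j : ℕ) + 1 ≤ c → c ≠ j → c < j := fun h1 h2 =>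
        lt_of_le_of_ne (not_lt.1 h1) h2
      by_cases h1 : (b = j ∧ Relation.TransGen T.Step j a) ∨
          (a = j ∧ Relation.TransGen T.Step j b)
      · rw [if_pos h1, if_pos]
        rcases h1 with ⟨rfl, -⟩ | ⟨rfl, -⟩
        · exact Or.inr le_rfl
        · exact Or.inl le_rfl
      rw [if_neg h1]
      by_cases h2 : a = j ∧ b = j
      · obtain ⟨rfl, rfl⟩ := h2
        simp
      rw [if_neg h2]
      by_cases h3 : (j : ℕ) + 1 ≤ a ∨ (j : ℕ) + 1 ≤ b
      · rw [if_pos h3, if_pos (h3.imp Nat.le_of_succ_le Nat.le_of_succ_le)]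
      rw [if_neg h3]
      rw [not_or] at h1 h3
      by_cases ha : a = j
      · subst ha
        have hb : b ≠ a := fun e => h2 ⟨rfl, e⟩
        rw [(h0 (hlt h3.2 hb) fun e => h1.2 ⟨rfl, e⟩).2, ite_self]
      · by_cases hb : b = j
        · subst hb
          rw [(h0 (hlt h3.1 ha) fun e => h1.1 ⟨rfl, e⟩).1, ite_self]
        · rw [if_neg]
          exact not_or.2 ⟨not_le.2 (hlt h3.1 ha), not_le.2 (hlt h3.2 hb)⟩
    · intro a ha
      simp only [Matrix.of_apply, h.axisDot_eq]
      refine ⟨T.bodySum_ancestor_left q B axisDot ha, ?_⟩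
      -- Symmetry of the composite inertia produces F₂, and transposing the composite B produces F₃.
      rw [T.bodySum_ancestor_right q B axisDot ha, dotProduct_add,
        dotProduct_mulVec_comm_of_symm hIs, Matrix.dotProduct_mulVec _ (T.composite q B j),
        ← Matrix.mulVec_transpose, dotProduct_comm _ (T.transport q a j *ᵥ T.axis q a)]

theorem Tree.coriolisAlgorithm_C (T : Tree N) (B : SpatialVec → SpatialMat → SpatialMat)
    (q qd : Fin N → ℝ) :
    (T.coriolisAlgorithm B q qd).C = Matrix.of (T.bodySum q
      (fun k => B (T.velocity q qd k) (T.inertia k).toMat)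
      (fun k => motionCross (T.velocity q qd k) *ᵥ T.axis q k + T.axisRate q qd k)) := by
  have hf := T.forwardInv_foldl B q qd
  -- At m = N no child has been added and no entry is final, so the invariant reduces to the output
  -- of the forward loop.
  have hN : ∀ c : Fin N, ¬ N ≤ c := fun c => not_le.2 c.2
  have h := foldl_reverse_finRange_induction (T.backwardStep q)
    (T.BackwardInv q _ _) (T.backwardInv_step q
      (fun k => B (T.velocity q qd k) (T.inertia k).toMat)
      (fun k => motionCross (T.velocity q qd k) *ᵥ T.axis q k + T.axisRate q qd k))
    (σ := (List.finRange N).foldl (T.forwardStep B q qd) State.init)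
    ⟨funext fun k => hf.axisDot k k.2, fun k => by simp [hf.IC k k.2, hN],
      fun k => by simp [hf.BC k k.2, hN],
      fun a b => by simp [hf.C, hN]⟩
  ext a b
  rw [Tree.coriolisAlgorithm, h.C]
  simp

end RigidBodyTree

theorem proposition2 {N : ℕ} (T : RigidBodyTree.Tree N)
    (hT : ∀ (i : Fin N) (q qd : Fin N → ℝ), T.axisRate q qd i = 0) :
    (∀ i j : Fin N, Differentiable ℝ fun q : Fin N → ℝ => T.massMatrix q i j) ∧
      ∀ q qd : Fin N → ℝ,
        (T.coriolisAlgorithm RigidBodyTree.niemeyerSlotine q qd).C =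
          T.christoffelCoriolis q qd := by
  refine ⟨T.differentiable_massMatrix, fun q qd => ?_⟩
  ext i j
  rw [T.coriolisAlgorithm_C, T.christoffelCoriolis_apply (T.hasDerivAt_axis hT)]
  simp only [hT, add_zero, Matrix.of_apply]
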